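/- **Setting.** Let $b,c\in\mathbb R^d$, let $\mathcal X=\prod_{j=1}^d[b_j,c_j]$, let $L\ge 0$ be an integer and $K=2^L$, $[K]=\{1,\dots,K\}$. For a product set $\Gamma=\prod_j\Gamma_j\subset\mathcal X$, a *tree partition of depth $0$* of $\Gamma$ is $\{\Gamma\}$; a *tree partition of depth $\ell\ge1$* of $\Gamma$ consists of the cells of a tree partition of depth $\ell-1$ of $\{x\in\Gamma:x_j\le\gamma\}$ together with the cells of a tree partition of depth $\ell-1$ of $\{x\in\Gamma:x_j>\gamma\}$, for some $j\in\{1,\dots,d\}$ and $\gamma\in\Gamma_j$ (an empty set may be cut anywhere; its cells are empty). A *stratification tree* of depth $L$ is a pair $T=(S,\pi)$, where $S:\mathcal X\to[K]$ is such that $\{S^{-1}(k)\}_{k\in[K]}$ are the $2^L$ (possibly empty) cells of a tree partition of depth $L$ of $\mathcal X$, labelled in any order, and $\pi\in[0,1]^K$. Let $\mathcal T$ be any set of stratification trees of depth $L$. Let $(Y_i(0),Y_i(1),X_i)$, $i=1,2,\dots$, be i.i.d. random vectors in $\mathbb R\times\mathbb R\times\mathcal X$. For $T=(S,\pi)\in\mathcal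 T$ put $S_i=S(X_i)$, $S^{(n)}=(S_i)_{i=1}^n$, $n(k;T)=\sum_{i=1}^n\mathbf 1\{S_i=k\}$ and $p(k;T)=P(S(X_1)=k)$. A randomization procedure is a family of random vectors $A^{(n)}(T)=(A_i(T))_{i=1}^n\in\{0,1\}^n$, $n\ge 0$, $T\in\mathcal T$; put $n_1(k;T)=\sum_{i=1}^n\mathbf 1\{A_i(T)=1,\ S_i=k\}$. It is *stratified block randomization* (SBR) if, for all $n$: * almost surely, $n_1(k;T)=\lfloor n(k;T)\,\pi(k)\rfloor$ for all $T=(S,\pi)\in\mathcal T$ and all $k\in[K]$; * for each $T=(S,\pi)\in\mathcal T$, units are chosen at random: conditionally on the sample $(Y_i(0),Y_i(1),X_i)_{i=1}^n$, independently across strata, all $\binom{n(k;T)}{\lfloor n(k;T)\pi(k)\rfloor}$ assignments of $\lfloor n(k;T)\pi(k)\rfloor$ of the $n(k;T)$ units of stratum $k$ to treatment $1$ are equally likely. **Proposition.** Suppose that randomization is performed through SBR. Then: 1. (Conditional exogeneity) for every $n$ and every $T\in\mathcal T$, the sample $(Y_i(0),Y_i(1),X_i)_{i=1}^n$ and $A^{(n)}(T)$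 are conditionally independent given $S^{(n)}$; 2. (Uniform consistency) for every $k\in[K]$, $$\sup_{T=(S,\pi)\in\mathcal T}\left|\frac{n_1(k;T)}{n}-\pi(k)\,p(k;T)\right|\xrightarrow{p}0\qquad(n\to\infty),$$ where convergence in probability is in outer probability if the supremum is not measurable. -/

import Mathlib

open MeasureTheory ProbabilityTheory Filter Topology

namespace StratRand

/-! ### Stratification trees -/

/-- Binary trees of depth `L` whose inner nodes carry a cut `(j, γ)` of the `j`-th coordinate at
the value `γ`. -/
inductive CutTree (d : ℕ) : ℕ → Type
  | leaf : CutTree d 0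
  | node {L : ℕ} (j : Fin d) (γ : ℝ) (down up : CutTree d L) : CutTree d (L + 1)

/-- The tree may be used to split the product set `Γ = ∏ j, Γ j`: the cut `(j, γ)` at the root has
`γ ∈ Γ j`, and the left and right subtrees may be used to split `Γ_D = {x ∈ Γ : x j ≤ γ}` and
`Γ_U = {x ∈ Γ : x j > γ}`. Nothing is required of the cuts of an empty set. -/
def CutTree.Splits {d : ℕ} : {L : ℕ} → CutTree d L → (Fin d → Set ℝ) → Prop
  | _, .leaf, _ => True
  | _, .node j γ down up, Γ =>
      ((Set.univ.pi Γ).Nonempty → γ ∈ Γ j) ∧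
      down.Splits (Function.update Γ j (Γ j ∩ Set.Iic γ)) ∧
      up.Splits (Function.update Γ j (Γ j ∩ Set.Ioi γ))

/-- The leaf into which a point falls, as the sequence of branches taken from the root
(`false` for down, i.e. `x j ≤ γ`, and `true` for up, i.e. `x j > γ`). -/
noncomputable def CutTree.leafOf {d : ℕ} :
    {L : ℕ} → CutTree d L → (Fin d → ℝ) → (Fin L → Bool)
  | _, .leaf, _ => Fin.elim0
  | _, .node j γ down up, x =>
      open Classical in
      if x j ≤ γ then Fin.cons false (down.leafOf x) else Fin.cons true (up.leafOf x)

/-- `S : 𝒳 → [K]`, with `𝒳 = ∏ j, [b j, c j]` and `K = 2 ^ L`, forms a tree partition of depth `L`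
of `𝒳`: its level sets are the (possibly empty) leaves of a tree of depth `L` on `𝒳`, labelled in
any order. -/
def IsTreePartition {d L : ℕ} {b c : Fin d → ℝ} (S : Set.Icc b c → Fin (2 ^ L)) : Prop :=
  ∃ τ : CutTree d L, τ.Splits (fun j => Set.Icc (b j) (c j)) ∧
    ∃ e : (Fin L → Bool) ≃ Fin (2 ^ L), ∀ x : Set.Icc b c, S x = e (τ.leafOf x.1)

/-- A stratification tree `T = (S, π)` of depth `L` on the box `∏ j, [b j, c j]`. -/
structure StratTree {d : ℕ} (b c : Fin d → ℝ) (L : ℕ) where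
  /-- the stratum of a covariate value -/
  S : Set.Icc b c → Fin (2 ^ L)
  isTreePartition : IsTreePartition S
  /-- the target proportions of units assigned to treatment 1 -/
  π : Fin (2 ^ L) → ℝ
  π_mem : ∀ k, π k ∈ Set.Icc (0 : ℝ) 1

/-! ### Samples and stratified block randomization -/

/-- `n(k)`: the number of units in stratum `k`, for the vector of strata labels `s`. -/
def numUnits {n K : ℕ} (s : Fin n → Fin K) (k : Fin K) : ℕ :=
  (Finset.univ.filter fun i => s i = k).card

/-- `n₁(k)`: the number of units in stratum `k` that the assignment `a` assigns to treatment `1`. -/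
def numTreated {n K : ℕ} (a : Fin n → Fin 2) (s : Fin n → Fin K) (k : Fin K) : ℕ :=
  (Finset.univ.filter fun i => a i = 1 ∧ s i = k).card

/-- The number `⌊n(k) π(k)⌋` of units that stratified block randomization treats in stratum `k`. -/
noncomputable def blockSize {n K : ℕ} (π : Fin K → ℝ) (s : Fin n → Fin K) (k : Fin K) : ℕ :=
  ⌊(numUnits s k : ℝ) * π k⌋₊

open Classical in
/-- The probability with which stratified block randomization draws the assignment `a` when the
strata labels are `s`: in each stratum `k`, independently across strata, all the
`n(k).choose ⌊n(k) π(k)⌋` assignments with exactly `⌊n(k) π(k)⌋` treated units are equally likely. -/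
noncomputable def blockProb {n K : ℕ} (π : Fin K → ℝ) (s : Fin n → Fin K) (a : Fin n → Fin 2) : ℝ :=
  ∏ k, if numTreated a s k = blockSize π s k
    then (((numUnits s k).choose (blockSize π s k) : ℕ) : ℝ)⁻¹ else 0

section

variable {Ω : Type*} [MeasurableSpace Ω] {d L : ℕ} {b c : Fin d → ℝ}

/-- The first `n` observations `(Y_i(0), Y_i(1), X_i)` of a sequence. -/
def sample (W : ℕ → Ω → ℝ × ℝ × Set.Icc b c) (n : ℕ) (ω : Ω) : Fin n → ℝ × ℝ × Set.Icc b c :=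
  fun i => W i ω

/-- The vector of strata labels `S^(n) = (S(X_i))_i` of the first `n` observations. -/
def strata (W : ℕ → Ω → ℝ × ℝ × Set.Icc b c) (T : StratTree b c L) (n : ℕ) (ω : Ω) :
    Fin n → Fin (2 ^ L) :=
  fun i => T.S (W i ω).2.2

/-- The randomization procedure `A`, with `A n T` the vector of treatments of the first `n` units
when the tree `T` is used, is stratified block randomization for the trees in `𝒯`. -/
structure IsSBR (μ : Measure Ω) (W : ℕ → Ω → ℝ × ℝ × Set.Icc b c) (𝒯 : Set (StratTree b c L))
    (A : (n : ℕ) → StratTree b c L → Ω → Fin n → Fin 2) : Prop where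
  measurable : ∀ n, ∀ T ∈ 𝒯, Measurable (A n T)
  /-- In each stratum exactly `⌊n(k) π(k)⌋` units are treated. For one tree, or countably many, this
  follows from `condProb`; for an uncountable class the exceptional null set is a common one. -/
  numTreated_eq : ∀ n, ∀ᵐ ω ∂μ, ∀ T ∈ 𝒯, ∀ k,
    numTreated (A n T ω) (strata W T n ω) k = blockSize T.π (strata W T n ω) k
  /-- Given the sample, all admissible assignments are equally likely. -/
  condProb : ∀ n, ∀ T ∈ 𝒯, ∀ a : Fin n → Fin 2,
    μ⟦A n T ⁻¹' {a} | MeasurableSpace.comap (sample W n) inferInstance⟧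
      =ᵐ[μ] fun ω => blockProb T.π (strata W T n ω) a

end

/-! ### Conditional independence

`ProbabilityTheory.CondIndepFun` is only available on standard Borel spaces; the following is the
same notion on an arbitrary probability space. -/

/-- `f` and `g` are conditionally independent given the sigma-algebra `m`. -/
def CondIndepGiven {Ω β γ : Type*} (m : MeasurableSpace Ω) {mΩ : MeasurableSpace Ω}
    [MeasurableSpace β] [MeasurableSpace γ] (f : Ω → β) (g : Ω → γ) (μ : Measure Ω) : Prop :=
  m ≤ mΩ ∧ ∀ s t, MeasurableSet s → MeasurableSet t →
    μ⟦f ⁻¹' s ∩ g ⁻¹' t | m⟧ =ᵐ[μ] fun ω => (μ⟦f ⁻¹' s | m⟧) ω * (μ⟦g ⁻¹' t | m⟧) ω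

theorem condIndepGiven_iff_condIndepFun {Ω β γ : Type*} {m : MeasurableSpace Ω}
    {mΩ : MeasurableSpace Ω} [StandardBorelSpace Ω] [MeasurableSpace β] [MeasurableSpace γ]
    (hm : m ≤ mΩ) {f : Ω → β} {g : Ω → γ} (hf : Measurable f) (hg : Measurable g)
    {μ : Measure Ω} [IsFiniteMeasure μ] :
    CondIndepGiven m f g μ ↔ ProbabilityTheory.CondIndepFun m hm f g μ := by
  rw [condIndepFun_iff_condExp_inter_preimage_eq_mul hf hg]
  exact ⟨fun h => h.2, fun h => ⟨hm, h⟩⟩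

end StratRand

open StratRand

/-! Exogeneity: given the whole sample, the assignment has law `blockProb`, which sees the sample
only through the strata labels. The tower property and pulling out known factors then give
conditional independence given the labels (`condIndepGiven_of_condExp_eq`). Consistency: almost
surely the treated count is `⌊n(k) π(k)⌋` for all trees at once, so up to a rounding error of `1 /
n` the deviation is at most that of the empirical frequency of the stratum from its probability.
What remains is a Glivenko–Cantelli theorem for tree cells. For every `ε` the cells lie in finitely
many brackets of mass at most `ε` (`hasFiniteBracketing_leafOf`, by induction on depth from
half-spaces), and the strong law at the finitely many endpoints controls all cells simultaneously.
-/

namespace StratRand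

/-! ### Finite bracketing of tree cells -/

section Brackets

variable {E : Type*} [MeasurableSpace E] {Q : Measure E} {𝒞 𝒟 : Set (Set E)} {ε δ : ℝ}

/-- `𝒞` is covered by finitely many brackets `[l, u]` of measurable sets with `Q (u \ l) ≤ ε`. -/
def HasFiniteBracketing (Q : Measure E) (ε : ℝ) (𝒞 : Set (Set E)) : Prop :=
  ∃ B : Set (Set E × Set E), B.Finite ∧
    (∀ p ∈ B, MeasurableSet p.1 ∧ MeasurableSet p.2 ∧ Q.real (p.2 \ p.1) ≤ ε) ∧
    ∀ C ∈ 𝒞, ∃ p ∈ B, p.1 ⊆ C ∧ C ⊆ p.2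

theorem HasFiniteBracketing.mono (h : HasFiniteBracketing Q ε 𝒟) (h𝒞 : 𝒞 ⊆ 𝒟) :
    HasFiniteBracketing Q ε 𝒞 := by
  obtain ⟨B, hB, hm, hc⟩ := h
  exact ⟨B, hB, hm, fun C hC => hc C (h𝒞 hC)⟩

theorem HasFiniteBracketing.union (h𝒞 : HasFiniteBracketing Q ε 𝒞)
    (h𝒟 : HasFiniteBracketing Q ε 𝒟) : HasFiniteBracketing Q ε (𝒞 ∪ 𝒟) := by
  obtain ⟨B, hB, hm, hc⟩ := h𝒞
  obtain ⟨B', hB', hm', hc'⟩ := h𝒟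
  refine ⟨B ∪ B', hB.union hB', fun p hp => hp.elim (hm p) (hm' p), ?_⟩
  rintro C (hC | hC)
  · obtain ⟨p, hp, h⟩ := hc C hC
    exact ⟨p, Or.inl hp, h⟩
  · obtain ⟨p, hp, h⟩ := hc' C hC
    exact ⟨p, Or.inr hp, h⟩

theorem hasFiniteBracketing_of_bracket {l u : Set E} (hl : MeasurableSet l) (hu : MeasurableSet u)
    (hlu : Q.real (u \ l) ≤ ε) (h : ∀ C ∈ 𝒞, l ⊆ C ∧ C ⊆ u) : HasFiniteBracketing Q ε 𝒞 :=
  ⟨{(l, u)}, Set.finite_singleton _, by rintro p rfl; exact ⟨hl, hu, hlu⟩,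
    fun C hC => ⟨_, rfl, h C hC⟩⟩

theorem hasFiniteBracketing_singleton (hε : 0 ≤ ε) {C : Set E} (hC : MeasurableSet C) :
    HasFiniteBracketing Q ε {C} :=
  hasFiniteBracketing_of_bracket hC hC (by simpa using hε) (by rintro _ rfl; simp)

theorem HasFiniteBracketing.compl (h : HasFiniteBracketing Q ε 𝒞) :
    HasFiniteBracketing Q ε (compl '' 𝒞) := by
  obtain ⟨B, hB, hm, hc⟩ := h
  refine ⟨(fun p => (p.2ᶜ, p.1ᶜ)) '' B, hB.image _, ?_, ?_⟩
  · rintro _ ⟨p, hp, rfl⟩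
    obtain ⟨h₁, h₂, h₃⟩ := hm p hp
    refine ⟨h₂.compl, h₁.compl, ?_⟩
    rwa [compl_sdiff_compl]
  · rintro _ ⟨C, hC, rfl⟩
    obtain ⟨p, hp, h₁, h₂⟩ := hc C hC
    exact ⟨_, ⟨p, hp, rfl⟩, Set.compl_subset_compl.2 h₂, Set.compl_subset_compl.2 h₁⟩

theorem HasFiniteBracketing.inter [IsFiniteMeasure Q] (h𝒞 : HasFiniteBracketing Q ε 𝒞)
    (h𝒟 : HasFiniteBracketing Q δ 𝒟) :
    HasFiniteBracketing Q (ε + δ) (Set.image2 (· ∩ ·) 𝒞 𝒟) := by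
  obtain ⟨B, hB, hm, hc⟩ := h𝒞
  obtain ⟨B', hB', hm', hc'⟩ := h𝒟
  refine ⟨Set.image2 (fun p q => (p.1 ∩ q.1, p.2 ∩ q.2)) B B', hB.image2 _ hB', ?_, ?_⟩
  · rintro _ ⟨p, hp, q, hq, rfl⟩
    obtain ⟨h₁, h₂, h₃⟩ := hm p hp
    obtain ⟨h₁', h₂', h₃'⟩ := hm' q hq
    refine ⟨h₁.inter h₁', h₂.inter h₂', ?_⟩
    calc Q.real ((p.2 ∩ q.2) \ (p.1 ∩ q.1)) ≤ Q.real ((p.2 \ p.1) ∪ (q.2 \ q.1)) := by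
          refine measureReal_mono ?_
          intro x hx
          simp only [Set.mem_sdiff, Set.mem_inter_iff, Set.mem_union] at hx ⊢
          tauto
      _ ≤ _ := (measureReal_union_le _ _).trans (add_le_add h₃ h₃')
  · rintro _ ⟨C, hC, D, hD, rfl⟩
    obtain ⟨p, hp, h₁, h₂⟩ := hc C hC
    obtain ⟨q, hq, h₁', h₂'⟩ := hc' D hD
    exact ⟨_, ⟨p, hp, q, hq, rfl⟩, Set.inter_subset_inter h₁ h₁', Set.inter_subset_inter h₂ h₂'⟩

/-- Continuity from above: the sets decrease to `∅` as `r ↓ a`. The interval is open at `a`, so an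
atom of `g` there does no harm. -/
theorem exists_measureReal_preimage_Ioo_le (Q : Measure E) [IsFiniteMeasure Q] {g : E → ℝ}
    (hg : Measurable g) (a : ℝ) (hε : 0 < ε) : ∃ r > a, Q.real (g ⁻¹' Set.Ioo a r) ≤ ε := by
  have h := tendsto_measure_biInter_gt (μ := Q) (s := fun r => g ⁻¹' Set.Ioo a r) (a := a)
    (fun r _ => (hg measurableSet_Ioo).nullMeasurableSet)
    (fun i j _ hij => Set.preimage_mono (Set.Ioo_subset_Ioo_right hij))
    ⟨a + 1, by simp, measure_ne_top _ _⟩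
  have h0 : (⋂ r > a, g ⁻¹' Set.Ioo a r) = ∅ := by
    ext x
    simp only [Set.mem_iInter, Set.mem_preimage, Set.mem_Ioo, Set.mem_empty_iff_false, iff_false]
    intro hx
    exact lt_irrefl _ (hx (g x) (hx (a + 1) (by simp)).1).2
  rw [h0, measure_empty] at h
  have h' := (h.eventually (ge_mem_nhds (ENNReal.ofReal_pos.2 hε))).and self_mem_nhdsWithin
  obtain ⟨r, hr, hra⟩ := h'.exists
  exact ⟨r, hra, ENNReal.toReal_le_of_le_ofReal hε.le hr⟩

/-- Half-lines in the values of a bounded function can be bracketed. -/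
theorem hasFiniteBracketing_sublevel (Q : Measure E) [IsFiniteMeasure Q] {g : E → ℝ}
    (hg : Measurable g) {m M : ℝ} (hgm : ∀ x, g x ∈ Set.Icc m M) (hε : 0 < ε) :
    HasFiniteBracketing Q ε (Set.range fun γ : ℝ => {x | g x ≤ γ}) := by
  have key : HasFiniteBracketing Q ε ((fun γ : ℝ => {x | g x ≤ γ}) '' Set.Icc m M) := by
    -- By compactness it suffices to bracket the thresholds near each `γ`. The threshold `γ` itself
    -- gets its own bracket; those strictly below or above it then vary only over an open interval
    -- ending at `γ`, whose mass is small even if `γ` is an atom.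
    refine isCompact_Icc.induction_on
      (p := fun s => HasFiniteBracketing Q ε ((fun γ : ℝ => {x | g x ≤ γ}) '' s)) ?_ ?_ ?_ ?_
    · exact ⟨∅, Set.finite_empty, by simp, by simp⟩
    · exact fun s t hst ht => ht.mono (Set.image_mono hst)
    · intro s t hs ht
      rw [Set.image_union]
      exact hs.union ht
    · intro γ _
      obtain ⟨r, hr, hrε⟩ := exists_measureReal_preimage_Ioo_le Q hg γ hε
      obtain ⟨q, hq, hqε⟩ := exists_measureReal_preimage_Ioo_le Q hg.neg (-γ) hε
      refine ⟨Set.Ioo (-q) r,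
        mem_nhdsWithin_of_mem_nhds (Ioo_mem_nhds (by linarith) hr), ?_⟩
      have hlow : HasFiniteBracketing Q ε ((fun γ : ℝ => {x | g x ≤ γ}) '' Set.Ioo (-q) γ) := by
        refine hasFiniteBracketing_of_bracket (l := {x | g x ≤ -q}) (u := {x | g x < γ})
          (hg measurableSet_Iic) (hg measurableSet_Iio) ?_ ?_
        · refine (measureReal_mono ?_).trans hqε
          rintro x ⟨hx₁, hx₂⟩
          simp only [Set.mem_ofPred_eq, not_le, Set.mem_preimage, Set.mem_Ioo, Pi.neg_apply]
            at hx₁ hx₂ ⊢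
          constructor <;> linarith
        · rintro _ ⟨c, hc, rfl⟩
          exact ⟨fun x (hx : g x ≤ -q) => hx.trans hc.1.le, fun x (hx : g x ≤ c) =>
            hx.trans_lt hc.2⟩
      have hhigh : HasFiniteBracketing Q ε ((fun γ : ℝ => {x | g x ≤ γ}) '' Set.Ioo γ r) := by
        refine hasFiniteBracketing_of_bracket (l := {x | g x ≤ γ}) (u := {x | g x < r})
          (hg measurableSet_Iic) (hg measurableSet_Iio) ?_ ?_
        · refine (measureReal_mono ?_).trans hrε
          rintro x ⟨hx₁, hx₂⟩
          simp only [Set.mem_ofPred_eq, not_le, Set.mem_preimage, Set.mem_Ioo] at hx₁ hx₂ ⊢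
          exact ⟨hx₂, hx₁⟩
        · rintro _ ⟨c, hc, rfl⟩
          exact ⟨fun x (hx : g x ≤ γ) => hx.trans hc.1.le, fun x (hx : g x ≤ c) =>
            hx.trans_lt hc.2⟩
      have hmid : HasFiniteBracketing Q ε {{x | g x ≤ γ}} :=
        hasFiniteBracketing_singleton hε.le (hg measurableSet_Iic)
      refine ((hlow.union hmid).union hhigh).mono ?_
      rintro _ ⟨c, hc, rfl⟩
      rcases lt_trichotomy c γ with h | rfl | h
      · exact Or.inl (Or.inl ⟨c, ⟨hc.1, h⟩, rfl⟩)
      · exact Or.inl (Or.inr rfl)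
      · exact Or.inr ⟨c, ⟨h, hc.2⟩, rfl⟩
  -- Thresholds outside `[m, M]` cut off nothing or everything.
  refine ((key.union (hasFiniteBracketing_singleton hε.le MeasurableSet.empty)).union
    (hasFiniteBracketing_singleton hε.le MeasurableSet.univ)).mono ?_
  rintro _ ⟨c, rfl⟩
  by_cases h₁ : c < m
  · refine Or.inl (Or.inr ?_)
    ext x
    simpa using h₁.trans_le (hgm x).1
  by_cases h₂ : M < c
  · refine Or.inr ?_
    ext x
    simpa using (hgm x).2.trans h₂.le
  exact Or.inl (Or.inl ⟨c, ⟨not_lt.1 h₁, not_lt.1 h₂⟩, rfl⟩)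

/-- The cells of all trees of depth `L` can be bracketed. -/
theorem hasFiniteBracketing_leafOf (Q : Measure E) [IsFiniteMeasure Q] {d : ℕ} {b c : Fin d → ℝ}
    {g : E → Fin d → ℝ} (hg : Measurable g) (hgm : ∀ x, g x ∈ Set.Icc b c) (L : ℕ) :
    ∀ {ε : ℝ}, 0 < ε → HasFiniteBracketing Q ε
      (Set.range fun p : CutTree d L × (Fin L → Bool) => {x | p.1.leafOf (g x) = p.2}) := by
  induction L with
  | zero =>
    intro ε hε
    refine (hasFiniteBracketing_singleton hε.le MeasurableSet.univ).mono ?_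
    rintro _ ⟨p, rfl⟩
    exact Set.eq_univ_of_forall fun x => Subsingleton.elim _ _
  | succ L ih =>
    intro ε hε
    have hhalf (j : Fin d) : HasFiniteBracketing Q (ε / 2)
        (Set.range fun γ : ℝ => {x | g x j ≤ γ}) :=
      hasFiniteBracketing_sublevel Q (measurable_pi_iff.1 hg j)
        (fun x => ⟨(hgm x).1 j, (hgm x).2 j⟩) (half_pos hε)
    have hunion : HasFiniteBracketing Q (ε / 2)
        (⋃ j ∈ (Finset.univ : Finset (Fin d)), Set.range fun γ : ℝ => {x | g x j ≤ γ}) := by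
      refine Finset.induction_on (Finset.univ : Finset (Fin d)) ?_ ?_
      · exact ⟨∅, Set.finite_empty, by simp, by simp⟩
      · intro j s _ hs
        rw [Finset.set_biUnion_insert]
        exact (hhalf j).union hs
    -- A cell of depth `L + 1` is a half-space or its complement, intersected with a cell of depth
    -- `L`; each factor gets error `ε / 2`.
    have hcell := (hunion.union hunion.compl).inter (ih (half_pos hε))
    rw [add_halves] at hcell
    refine hcell.mono ?_
    rintro _ ⟨⟨τ, v⟩, rfl⟩
    cases τ with
    | node j γ down up =>
      have hmem : {x | g x j ≤ γ} ∈
          ⋃ j ∈ (Finset.univ : Finset (Fin d)), Set.range fun γ : ℝ => {x | g x j ≤ γ} :=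
        Set.mem_biUnion (Finset.mem_coe.2 (Finset.mem_univ j)) ⟨γ, rfl⟩
      cases hv : v 0 with
      | false =>
        refine ⟨_, Or.inl hmem, _, ⟨(down, Fin.tail v), rfl⟩, ?_⟩
        ext x
        have hv' : v = Fin.cons false (Fin.tail v) := by rw [← hv, Fin.cons_self_tail]
        by_cases hx : g x j ≤ γ
        · simp only [CutTree.leafOf, hx, if_true, Set.mem_inter_iff, Set.mem_ofPred_eq, true_and]
          conv_rhs => rw [hv', Fin.cons_inj]
          simp
        · simp only [CutTree.leafOf, hx, if_false, Set.mem_inter_iff, Set.mem_ofPred_eq, false_and]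
          conv_rhs => rw [hv', Fin.cons_inj]
          simp
      | true =>
        refine ⟨_, Or.inr ⟨_, hmem, rfl⟩, _, ⟨(up, Fin.tail v), rfl⟩, ?_⟩
        ext x
        have hv' : v = Fin.cons true (Fin.tail v) := by rw [← hv, Fin.cons_self_tail]
        by_cases hx : g x j ≤ γ
        · simp only [CutTree.leafOf, hx, if_true, Set.mem_inter_iff, Set.mem_compl_iff,
            Set.mem_ofPred_eq, not_true, false_and]
          conv_rhs => rw [hv', Fin.cons_inj]
          simp
        · simp only [CutTree.leafOf, hx, if_false, Set.mem_inter_iff, Set.mem_compl_iff,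
            Set.mem_ofPred_eq, not_false_eq_true, true_and]
          conv_rhs => rw [hv', Fin.cons_inj]
          simp

end Brackets

/-! ### Uniform law of large numbers -/

section UniformLaw

variable {Ω E : Type*}

open Classical in
/-- The fraction of the first `n` observations that lie in `C`. -/
noncomputable def empiricalFreq (W : ℕ → Ω → E) (C : Set E) (n : ℕ) (ω : Ω) : ℝ :=
  ((Finset.univ.filter fun i : Fin n => W i ω ∈ C).card : ℝ) / n

theorem empiricalFreq_mono (W : ℕ → Ω → E) {C D : Set E} (h : C ⊆ D) (n : ℕ) (ω : Ω) :
    empiricalFreq W C n ω ≤ empiricalFreq W D n ω := by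
  classical
  unfold empiricalFreq
  gcongr

theorem empiricalFreq_eq_sum (W : ℕ → Ω → E) (C : Set E) (n : ℕ) (ω : Ω) :
    empiricalFreq W C n ω
      = (∑ i ∈ Finset.range n, C.indicator (fun _ => (1 : ℝ)) (W i ω)) / n := by
  classical
  rw [empiricalFreq, Finset.sum_range]
  simp [Set.indicator_apply, Finset.sum_boole]

variable [MeasurableSpace Ω] [MeasurableSpace E] {μ : Measure Ω} {Q : Measure E} {W : ℕ → Ω → E}

theorem measurable_empiricalFreq (hW : ∀ i, Measurable (W i)) {C : Set E} (hC : MeasurableSet C)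
    (n : ℕ) : Measurable (empiricalFreq W C n) := by
  simp only [funext (empiricalFreq_eq_sum W C n)]
  exact (Finset.measurable_fun_sum _ fun i _ =>
    (measurable_const.indicator hC).comp (hW i)).div_const _

theorem tendsto_empiricalFreq_ae [IsProbabilityMeasure μ] (hW : ∀ i, Measurable (W i))
    (hindep : iIndepFun W μ) (hlaw : ∀ i, μ.map (W i) = Q) {C : Set E} (hC : MeasurableSet C) :
    ∀ᵐ ω ∂μ, Tendsto (fun n => empiricalFreq W C n ω) atTop (𝓝 (Q.real C)) := by
  have hφ : Measurable (C.indicator fun _ => (1 : ℝ)) := measurable_const.indicator hC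
  have h := strong_law_ae_real (μ := μ) (fun i ω => C.indicator (fun _ => (1 : ℝ)) (W i ω))
    ?_ ?_ ?_
  · have hint : ∫ ω, C.indicator (fun _ => (1 : ℝ)) (W 0 ω) ∂μ = Q.real C := by
      rw [← hlaw 0, ← integral_map (hW 0).aemeasurable hφ.aestronglyMeasurable,
        integral_indicator_const _ hC]
      simp
    filter_upwards [h] with ω hω
    simpa only [empiricalFreq_eq_sum, hint] using hω
  · exact Integrable.comp_measurable ((integrable_const (1 : ℝ)).indicator hC) (hW 0)
  · exact fun i j hij => (hindep.indepFun hij).comp hφ hφ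
  · exact fun i => IdentDistrib.comp
      ⟨(hW i).aemeasurable, (hW 0).aemeasurable, (hlaw i).trans (hlaw 0).symm⟩ hφ

/-- A uniform law of large numbers over a class of sets with finite bracketing. The bound is by
a function that converges in probability, so no measurability of suprema is involved. -/
theorem HasFiniteBracketing.exists_abs_empiricalFreq_sub_le [IsProbabilityMeasure μ]
    (hW : ∀ i, Measurable (W i)) (hindep : iIndepFun W μ) (hlaw : ∀ i, μ.map (W i) = Q)
    {𝒞 : Set (Set E)} {ε : ℝ} (h : HasFiniteBracketing Q ε 𝒞) :
    ∃ R : ℕ → Ω → ℝ, TendstoInMeasure μ R atTop (fun _ => 0) ∧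
      ∀ n ω, ∀ C ∈ 𝒞, |empiricalFreq W C n ω - Q.real C| ≤ R n ω + ε := by
  have : IsProbabilityMeasure Q :=
    hlaw 0 ▸ Measure.isProbabilityMeasure_map (hW 0).aemeasurable
  obtain ⟨B, hB, hm, hc⟩ := h
  -- The random error at the two endpoints of a bracket. Members of `𝒞` are compared with these by
  -- monotonicity alone, so they need not be measurable.
  let r : Set E × Set E → ℕ → Ω → ℝ := fun p n ω =>
    |empiricalFreq W p.1 n ω - Q.real p.1| + |empiricalFreq W p.2 n ω - Q.real p.2|
  refine ⟨fun n ω => ∑ p ∈ hB.toFinset, r p n ω, ?_, ?_⟩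
  · refine tendstoInMeasure_of_tendsto_ae (fun n => ?_) ?_
    · refine (Finset.measurable_fun_sum _ fun p hp => ?_).aestronglyMeasurable
      obtain ⟨h₁, h₂, -⟩ := hm p (hB.mem_toFinset.1 hp)
      exact (((measurable_empiricalFreq hW h₁ n).sub_const _).abs).add
        (((measurable_empiricalFreq hW h₂ n).sub_const _).abs)
    · have hae : ∀ᵐ ω ∂μ, ∀ p ∈ hB.toFinset, Tendsto (fun n => r p n ω) atTop (𝓝 0) := by
        rw [Finset.eventually_all]
        intro p hp
        obtain ⟨h₁, h₂, -⟩ := hm p (hB.mem_toFinset.1 hp)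
        filter_upwards [tendsto_empiricalFreq_ae hW hindep hlaw h₁,
          tendsto_empiricalFreq_ae hW hindep hlaw h₂] with ω hω₁ hω₂
        simpa [r] using (hω₁.sub_const (Q.real p.1)).abs.add (hω₂.sub_const (Q.real p.2)).abs
      filter_upwards [hae] with ω hω
      simpa using tendsto_finsetSum _ hω
  · intro n ω C hC
    obtain ⟨p, hp, hl, hu⟩ := hc C hC
    obtain ⟨h₁, h₂, h₃⟩ := hm p hp
    have hr : r p n ω ≤ ∑ p ∈ hB.toFinset, r p n ω :=
      Finset.single_le_sum (f := fun p => r p n ω) (fun _ _ => by positivity)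
        (hB.mem_toFinset.2 hp)
    have hdiff : Q.real p.2 - Q.real p.1 ≤ ε := by
      rwa [← measureReal_sdiff (hl.trans hu) h₁]
    have h₄ := empiricalFreq_mono W hl n ω
    have h₅ := empiricalFreq_mono W hu n ω
    have h₆ : Q.real p.1 ≤ Q.real C := measureReal_mono hl
    have h₇ : Q.real C ≤ Q.real p.2 := measureReal_mono hu
    refine le_trans ?_ (add_le_add_left hr ε)
    simp only [r]
    rw [abs_le]
    constructor
    · linarith [neg_abs_le (empiricalFreq W p.1 n ω - Q.real p.1),
        abs_nonneg (empiricalFreq W p.2 n ω - Q.real p.2)]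
    · linarith [le_abs_self (empiricalFreq W p.2 n ω - Q.real p.2),
        abs_nonneg (empiricalFreq W p.1 n ω - Q.real p.1)]

end UniformLaw

/-! ### Conditional independence from a conditional law -/

section CondIndep

variable {Ω β γ : Type*} {m m' mΩ : MeasurableSpace Ω} [MeasurableSpace β] [MeasurableSpace γ]
  {μ : Measure Ω} [IsFiniteMeasure μ] {f : Ω → β} {g : Ω → γ}

/-- If the conditional law of `g` given a sigma-algebra `m` to which `f` is adapted is measurable
with respect to a smaller sigma-algebra `m'`, then `f` and `g` are conditionally independent
given `m'`. -/
theorem condIndepGiven_of_condExp_eq (hm' : m' ≤ m) (hm : m ≤ mΩ) (hf : Measurable[m] f)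
    (hg : Measurable g)
    (h : ∀ t, MeasurableSet t → ∃ H : Ω → ℝ, StronglyMeasurable[m'] H ∧
      μ⟦g ⁻¹' t | m⟧ =ᵐ[μ] H) : CondIndepGiven m' f g μ := by
  refine ⟨hm'.trans hm, fun s t hs ht => ?_⟩
  obtain ⟨H, hH, hHeq⟩ := h t ht
  have hfs : MeasurableSet[m] (f ⁻¹' s) := hf hs
  have hgt : MeasurableSet (g ⁻¹' t) := hg ht
  have hHint : Integrable H μ := integrable_condExp.congr hHeq
  have hint (u : Set Ω) (hu : MeasurableSet u) : Integrable (u.indicator fun _ => (1 : ℝ)) μ :=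
    (integrable_const 1).indicator hu
  -- `H` is already `m'`-measurable, so by the tower property it is also the conditional probability
  -- given `m'`.
  have hgH : μ⟦g ⁻¹' t | m'⟧ =ᵐ[μ] H := by
    refine (condExp_condExp_of_le hm' hm).symm.trans ((condExp_congr_ae hHeq).trans ?_)
    rw [condExp_of_stronglyMeasurable (hm'.trans hm) hH hHint]
  have hprod : ((f ⁻¹' s ∩ g ⁻¹' t).indicator fun _ => (1 : ℝ))
      = ((f ⁻¹' s).indicator fun _ => (1 : ℝ)) * ((g ⁻¹' t).indicator fun _ => (1 : ℝ)) := by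
    ext ω
    rw [Pi.mul_apply, ← Set.inter_indicator_mul]
    simp
  have hfm : StronglyMeasurable[m] ((f ⁻¹' s).indicator fun _ => (1 : ℝ)) :=
    stronglyMeasurable_const.indicator hfs
  have hpull : μ⟦f ⁻¹' s ∩ g ⁻¹' t | m⟧ =ᵐ[μ] ((f ⁻¹' s).indicator fun _ => (1 : ℝ)) * H := by
    rw [hprod]
    refine (condExp_mul_of_stronglyMeasurable_left hfm ?_ (hint _ hgt)).trans ?_
    · rw [← hprod]
      exact hint _ ((hm _ hfs).inter hgt)
    · exact EventuallyEq.rfl.mul hHeq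
  have hintH : Integrable (((f ⁻¹' s).indicator fun _ => (1 : ℝ)) * H) μ :=
    integrable_condExp.congr hpull
  calc μ⟦f ⁻¹' s ∩ g ⁻¹' t | m'⟧ =ᵐ[μ] μ[μ⟦f ⁻¹' s ∩ g ⁻¹' t | m⟧ | m'] :=
        (condExp_condExp_of_le hm' hm).symm
    _ =ᵐ[μ] μ[((f ⁻¹' s).indicator fun _ => (1 : ℝ)) * H | m'] := condExp_congr_ae hpull
    _ =ᵐ[μ] μ⟦f ⁻¹' s | m'⟧ * H :=
        condExp_mul_of_stronglyMeasurable_right hH hintH (hint _ (hm _ hfs))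
    _ =ᵐ[μ] _ := EventuallyEq.rfl.mul hgH.symm

end CondIndep

/-! ### Strata and block randomization -/

section Strata

variable {Ω : Type*} {d L : ℕ} {b c : Fin d → ℝ}

theorem CutTree.measurable_leafOf : ∀ {L : ℕ} (τ : CutTree d L), Measurable τ.leafOf
  | _, .leaf => measurable_const
  | _, .node j γ down up => by
    classical
    have hcons (v : Bool) {L : ℕ} : Measurable fun x : Fin L → Bool =>
        (Fin.cons v x : Fin (L + 1) → Bool) := measurable_of_finite _
    have h : Measurable fun x : Fin d → ℝ =>
        if x j ≤ γ then (Fin.cons false (down.leafOf x) : Fin (_ + 1) → Bool)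
        else Fin.cons true (up.leafOf x) :=
      Measurable.ite (measurableSet_le (measurable_pi_apply j) measurable_const)
        ((hcons false).comp down.measurable_leafOf) ((hcons true).comp up.measurable_leafOf)
    convert h using 1
    ext x
    simp only [CutTree.leafOf]

theorem StratTree.measurable_S (T : StratTree b c L) : Measurable T.S := by
  obtain ⟨τ, -, e, he⟩ := T.isTreePartition
  rw [funext he]
  exact (measurable_of_finite e).comp (τ.measurable_leafOf.comp measurable_subtype_coe)

theorem comap_strata_le (W : ℕ → Ω → ℝ × ℝ × Set.Icc b c) (T : StratTree b c L) (n : ℕ) :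
    MeasurableSpace.comap (strata W T n) inferInstance
      ≤ MeasurableSpace.comap (sample W n) inferInstance := by
  have h : strata W T n = (fun s i => T.S (s i).2.2) ∘ sample W n := rfl
  rw [h, ← MeasurableSpace.comap_comp]
  refine MeasurableSpace.comap_mono (Measurable.comap_le ?_)
  exact measurable_pi_iff.2 fun i =>
    T.measurable_S.comp (measurable_snd.comp (measurable_snd.comp (measurable_pi_apply i)))

theorem IsSBR.condIndepGiven [MeasurableSpace Ω] {μ : Measure Ω} [IsProbabilityMeasure μ]
    {W : ℕ → Ω → ℝ × ℝ × Set.Icc b c} (hW : ∀ i, Measurable (W i)) {𝒯 : Set (StratTree b c L)}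
    {A : (n : ℕ) → StratTree b c L → Ω → Fin n → Fin 2} (hA : IsSBR μ W 𝒯 A) (n : ℕ)
    {T : StratTree b c L} (hT : T ∈ 𝒯) :
    CondIndepGiven (MeasurableSpace.comap (strata W T n) inferInstance)
      (sample W n) (A n T) μ := by
  classical
  have hs : Measurable (sample W n) := measurable_pi_iff.2 fun i => hW i
  refine condIndepGiven_of_condExp_eq (comap_strata_le W T n) hs.comap_le
    (comap_measurable _) (hA.measurable n T hT) fun t _ => ?_
  -- There are finitely many assignments, so the law of any event is a finite sum of `blockProb`, a
  -- function of the labels.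
  refine ⟨(fun s => ∑ a with a ∈ t, blockProb T.π s a) ∘ strata W T n,
    ((measurable_of_finite _).comp (comap_measurable _)).stronglyMeasurable, ?_⟩
  have hsum : ((A n T ⁻¹' t).indicator fun _ => (1 : ℝ))
      = ∑ a with a ∈ t, (A n T ⁻¹' {a}).indicator fun _ => (1 : ℝ) := by
    ext ω
    simp [Set.indicator_apply, Finset.sum_apply]
  rw [hsum]
  refine (condExp_finsetSum (fun a _ => (integrable_const (1 : ℝ)).indicator
    (hA.measurable n T hT (measurableSet_singleton a))) _).trans ?_
  have hall : ∀ᵐ ω ∂μ, ∀ a : Fin n → Fin 2,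
      (μ⟦A n T ⁻¹' {a} | MeasurableSpace.comap (sample W n) inferInstance⟧) ω
        = blockProb T.π (strata W T n ω) a := ae_all_iff.2 (hA.condProb n T hT)
  filter_upwards [hall] with ω hω
  simp [hω]

theorem numUnits_div_eq_empiricalFreq (W : ℕ → Ω → ℝ × ℝ × Set.Icc b c) (T : StratTree b c L)
    (n : ℕ) (ω : Ω) (k : Fin (2 ^ L)) :
    (numUnits (strata W T n ω) k : ℝ) / n = empiricalFreq W {w | T.S w.2.2 = k} n ω := by
  simp only [numUnits, empiricalFreq, strata, Set.mem_ofPred_eq]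
  congr!

theorem abs_blockSize_div_sub_le {n K : ℕ} {π : Fin K → ℝ} {s : Fin n → Fin K} {k : Fin K}
    (hπ : π k ∈ Set.Icc (0 : ℝ) 1) (p : ℝ) :
    |(blockSize π s k : ℝ) / n - π k * p| ≤ |(numUnits s k : ℝ) / n - p| + 1 / n := by
  have hx : (0 : ℝ) ≤ numUnits s k * π k := mul_nonneg (Nat.cast_nonneg _) hπ.1
  have hfloor : |(blockSize π s k : ℝ) - numUnits s k * π k| ≤ 1 := by
    rw [abs_le, blockSize]
    constructor <;> linarith [Nat.floor_le hx, Nat.lt_floor_add_one ((numUnits s k : ℝ) * π k)]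
  have hsplit : (blockSize π s k : ℝ) / n - π k * p
      = π k * ((numUnits s k : ℝ) / n - p) + (blockSize π s k - numUnits s k * π k) / n := by
    ring
  rw [hsplit]
  refine (abs_add_le _ _).trans (add_le_add ?_ ?_)
  · rw [abs_mul, abs_of_nonneg hπ.1]
    exact mul_le_of_le_one_left (abs_nonneg _) hπ.2
  · rw [abs_div, Nat.abs_cast]
    gcongr

/-- Relabelling is harmless: stratum `k` is the cell of the leaf `e.symm k`. -/
theorem hasFiniteBracketing_strata (Q : Measure (ℝ × ℝ × Set.Icc b c)) [IsFiniteMeasure Q]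
    (k : Fin (2 ^ L)) {ε : ℝ} (hε : 0 < ε) :
    HasFiniteBracketing Q ε (Set.range fun T : StratTree b c L => {w | T.S w.2.2 = k}) := by
  refine (hasFiniteBracketing_leafOf Q (b := b) (c := c) (g := fun w => w.2.2.1)
    (measurable_subtype_coe.comp (measurable_snd.comp measurable_snd))
    (fun w => w.2.2.2) L hε).mono ?_
  rintro _ ⟨T, rfl⟩
  obtain ⟨τ, -, e, he⟩ := T.isTreePartition
  refine ⟨(τ, e.symm k), ?_⟩
  ext w
  simp [he, Equiv.eq_symm_apply]

theorem IsSBR.tendstoInMeasure_iSup [MeasurableSpace Ω] {μ : Measure Ω} [IsProbabilityMeasure μ]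
    {Q : Measure (ℝ × ℝ × Set.Icc b c)} {W : ℕ → Ω → ℝ × ℝ × Set.Icc b c}
    (hW : ∀ i, Measurable (W i)) (hindep : iIndepFun W μ) (hlaw : ∀ i, μ.map (W i) = Q)
    {𝒯 : Set (StratTree b c L)} {A : (n : ℕ) → StratTree b c L → Ω → Fin n → Fin 2}
    (hA : IsSBR μ W 𝒯 A) (k : Fin (2 ^ L)) :
    TendstoInMeasure μ
      (fun (n : ℕ) ω => ⨆ T : 𝒯,
        |(numTreated (A n T.1 ω) (strata W T.1 n ω) k : ℝ) / n
          - T.1.π k * Q.real {w | T.1.S w.2.2 = k}|)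
      atTop (fun _ => 0) := by
  have : IsProbabilityMeasure Q :=
    hlaw 0 ▸ Measure.isProbabilityMeasure_map (hW 0).aemeasurable
  rw [tendstoInMeasure_iff_norm]
  intro ε hε
  -- One third each for the strong-law error `R`, the bracket width and the rounding error `1 / n`.
  have hε3 : 0 < ε / 3 := by positivity
  obtain ⟨R, hR, hbound⟩ := (hasFiniteBracketing_strata Q k hε3).exists_abs_empiricalFreq_sub_le
    hW hindep hlaw
  rw [tendstoInMeasure_iff_norm] at hR
  refine tendsto_of_tendsto_of_tendsto_of_le_of_le' tendsto_const_nhds (hR (ε / 3) hε3)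
    (Eventually.of_forall fun _ => zero_le) ?_
  filter_upwards [tendsto_one_div_atTop_nhds_zero_nat.eventually (ge_mem_nhds hε3)] with n hn
  -- Only an almost sure inclusion of events is needed, so the supremum need not be measurable; the
  -- exceptional null set is common to all trees.
  refine measure_mono_ae ?_
  filter_upwards [hA.numTreated_eq n] with ω hω hsup
  by_contra hlt
  change ε ≤ ‖(⨆ T : 𝒯, _) - (0 : ℝ)‖ at hsup
  change ¬ ε / 3 ≤ ‖R n ω - 0‖ at hlt
  rw [sub_zero, Real.norm_eq_abs, abs_of_nonneg (Real.iSup_nonneg fun _ => abs_nonneg _)] at hsup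
  rw [sub_zero, Real.norm_eq_abs, not_le] at hlt
  -- `Real.iSup_le` also asks for a nonnegative bound, since the real supremum over an empty `𝒯` is
  -- `0`.
  refine absurd (hsup.trans (Real.iSup_le (a := |R n ω| + ε / 3 + ε / 3) (fun T => ?_) ?_)) ?_
  · rw [hω T.1 T.2 k]
    refine (abs_blockSize_div_sub_le (T.1.π_mem k) _).trans (add_le_add ?_ hn)
    rw [numUnits_div_eq_empiricalFreq]
    exact (hbound n ω _ ⟨T.1, rfl⟩).trans (by gcongr; exact le_abs_self _)
  · positivity
  · linarith

end Strata

end StratRand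

open StratRand
theorem proposition2p1 {Ω : Type*} [MeasurableSpace Ω] (μ : Measure Ω) [IsProbabilityMeasure μ]
    {d L : ℕ} {b c : Fin d → ℝ} (Q : Measure (ℝ × ℝ × Set.Icc b c))
    (W : ℕ → Ω → ℝ × ℝ × Set.Icc b c) (hW : ∀ i, Measurable (W i))
    (hindep : iIndepFun W μ) (hlaw : ∀ i, μ.map (W i) = Q)
    (𝒯 : Set (StratTree b c L)) (A : (n : ℕ) → StratTree b c L → Ω → Fin n → Fin 2)
    (hA : IsSBR μ W 𝒯 A) :
    (∀ n, ∀ T ∈ 𝒯, CondIndepGiven (MeasurableSpace.comap (strata W T n) inferInstance)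
      (sample W n) (A n T) μ) ∧
    ∀ k, TendstoInMeasure μ
      (fun (n : ℕ) ω => ⨆ T : 𝒯,
        |(numTreated (A n T.1 ω) (strata W T.1 n ω) k : ℝ) / n
          - T.1.π k * Q.real {w | T.1.S w.2.2 = k}|)
      atTop (fun _ => 0) :=
  ⟨fun n _ hT => hA.condIndepGiven hW n hT,
    fun k => hA.tendstoInMeasure_iSup hW hindep hlaw k⟩
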